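/- Let $D\subseteq\mathbb{C}$ be a domain (non-empty, open, connected), let $m\ge 1$ be an integer, and let $(f_n)_n$ be a sequence of meromorphic functions on $D$ such that $f_n^{(m)}\not\equiv 0$ on $D$ for every $n$. Suppose that $\big(f_n^{(m+1)}/f_n^{(m)}\big)_n$ converges locally uniformly on $D$ to a meromorphic function $F_m$ on $D$, and let $\mathcal{P}_{F_m}\subseteq D$ be the set of poles of $F_m$. Then there exist a subsequence $(f_{n_k})_k$ and a meromorphic function $F_{m-1}$ on $D\setminus\mathcal{P}_{F_m}$ such that $\big(f_{n_k}^{(m)}/f_{n_k}^{(m-1)}\big)_k$ converges locally uniformly on $D\setminus\mathcal{P}_{F_m}$ to $F_{m-1}$. Moreover, no subsequence of $\big(f_n^{(m)}/f_n^{(m-1)}\big)_n$ converges locally uniformly on $D\setminus\mathcal{P}_{F_m}$ to the constant $\infty$. Here locally uniform convergence is meant with respect to the spherical metric on $\mathbb{C}\cup\{\infty\}$, and meromorphic functions are never identically $\infty$. -/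

import Mathlib

open Filter Topology

noncomputable section

/-- Inverse stereographic projection from the extended complex plane onto the Euclidean unit
sphere in `ℂ × ℝ`; the point `∞` goes to the north pole. -/
def stereo : OnePoint ℂ → WithLp 2 (ℂ × ℝ)
  | none => WithLp.toLp 2 ((0 : ℂ), (1 : ℝ))
  | some z => WithLp.toLp 2
      (((2 / (1 + ‖z‖ ^ 2) : ℝ) : ℂ) * z, (‖z‖ ^ 2 - 1) / (‖z‖ ^ 2 + 1))

/-- The value in the extended complex plane at `z` of a function that is meromorphic at `z`:
it is `∞` at a pole, and the limit of `f` at `z` otherwise (so that removable singularities are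
filled in, and the actual value of `f` at the single point `z` plays no role). -/
def sphereValue (f : ℂ → ℂ) (z : ℂ) : OnePoint ℂ :=
  open Classical in
  if meromorphicOrderAt f z < 0 then OnePoint.infty
  else ((limUnder (𝓝[≠] z) f : ℂ) : OnePoint ℂ)

/-- The set of poles in `D` of a function that is meromorphic on `D`. -/
def polesOn (f : ℂ → ℂ) (D : Set ℂ) : Set ℂ :=
  {z ∈ D | meromorphicOrderAt f z < 0}

/-- Locally uniform convergence on `U` with respect to the spherical (chordal) metric, that is,
the Euclidean distance of the stereographic images. -/
def SphericallyTendsto (g : ℕ → ℂ → OnePoint ℂ) (G : ℂ → OnePoint ℂ) (U : Set ℂ) : Prop :=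
  TendstoLocallyUniformlyOn (fun n z => stereo (g n z)) (fun z => stereo (G z)) atTop U

end

/-!
Put `g n = iteratedDeriv (m - 1) (f n)`; the statement passes from `(g n)'' / (g n)' → F` to the
logarithmic derivatives `(g n)' / g n`, away from the poles of `F`.

Near a point `c` where `F` is finite, `(g n)'' / (g n)'` is eventually free of poles. Zeros and
poles of `(g n)'` would be poles of its logarithmic derivative, so `g n` is analytic there with
`(g n)'` zero-free (`MeromorphicOn.exists_analyticOnNhd_deriv_ne_zero`). Integrating the linear
equation for `(g n)'` twice gives, on a disc about `c`,
`(g n)' = (g n)' (c) * A n` and `g n = g n (c) + (g n)' (c) * B n`, where `A n → a` and `B n → b`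
locally uniformly, `b' = a` and `a` has no zeros
(`exists_tendstoLocallyUniformlyOn_of_logDeriv_deriv`). In homogeneous coordinates
`(g n)' / g n = [β * A n : α + β * B n]`, where `(α, β)` is the vector `(g n (c), (g n)' (c))`
normalised to norm one. Once these unit vectors converge along a subsequence, to `(α, β) ≠ 0` say,
the quotients converge on the sphere to `β a / (α + β b)`, the logarithmic derivative of
`α + β b`. As `a` has no zeros, `α + β b` is not identically zero, so the limit is meromorphic and
never the constant `∞` (`exists_nhds_forall_sphericallyTendsto_logDeriv`).

Countably many such discs cover the complement of the poles, compactness of the countable product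
of parameter spaces gives one subsequence for all of them, and the local limits glue
(`exists_subseq_sphericallyTendsto_logDeriv`). Since this applies to every subsequence of the `f n`
as well, no subsequence can converge to `∞`.
-/

noncomputable section

open Metric Set
open scoped ComplexConjugate

/-! ### The sphere in homogeneous coordinates -/

/-- The stereographic image of the point of the extended plane with homogeneous coordinates
`[p.1 : p.2]`, that is, of the quotient `p.1 / p.2` (which is `∞` when `p.2 = 0`). The value at
`p = 0` is a junk value. -/
def homogStereo (p : ℂ × ℂ) : WithLp 2 (ℂ × ℝ) :=
  WithLp.toLp 2 (((2 / (‖p.1‖ ^ 2 + ‖p.2‖ ^ 2) : ℝ) : ℂ) * (p.1 * conj p.2),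
    (‖p.1‖ ^ 2 - ‖p.2‖ ^ 2) / (‖p.1‖ ^ 2 + ‖p.2‖ ^ 2))

lemma sq_norm_add_sq_norm_pos {p : ℂ × ℂ} (hp : p ≠ 0) : 0 < ‖p.1‖ ^ 2 + ‖p.2‖ ^ 2 := by
  by_cases h : p.1 = 0
  · have : p.2 ≠ 0 := fun h' => hp (Prod.ext h h')
    have := norm_pos_iff.2 this
    positivity
  · have := norm_pos_iff.2 h
    positivity

lemma continuousAt_homogStereo {p : ℂ × ℂ} (hp : p ≠ 0) : ContinuousAt homogStereo p := by
  have h := (sq_norm_add_sq_norm_pos hp).ne'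
  refine (WithLp.prod_continuous_toLp 2 ℂ ℝ).continuousAt.comp (ContinuousAt.prodMk ?_ ?_)
  · refine ContinuousAt.mul (Complex.continuous_ofReal.continuousAt.comp ?_) ?_
    · exact ContinuousAt.div (by fun_prop) (by fun_prop) h
    · exact ContinuousAt.mul (by fun_prop)
        (Complex.continuous_conj.continuousAt.comp (by fun_prop))
  · exact ContinuousAt.div (by fun_prop) (by fun_prop) h

lemma homogStereo_smul {c : ℝ} (hc : c ≠ 0) (p : ℂ × ℂ) :
    homogStereo (c • p) = homogStereo p := by
  have h1 : ‖(c • p).1‖ ^ 2 = c ^ 2 * ‖p.1‖ ^ 2 := by simp [mul_pow]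
  have h2 : ‖(c • p).2‖ ^ 2 = c ^ 2 * ‖p.2‖ ^ 2 := by simp [mul_pow]
  have hc2 : c ^ 2 ≠ 0 := pow_ne_zero 2 hc
  have hcc : (c : ℂ) ≠ 0 := by exact_mod_cast hc
  unfold homogStereo
  rw [h1, h2, ← mul_add, ← mul_sub, mul_div_mul_left _ _ hc2]
  congr 2
  have : (c • p).1 * conj (c • p).2 = ((c ^ 2 : ℝ) : ℂ) * (p.1 * conj p.2) := by
    simp only [Prod.smul_fst, Prod.smul_snd, Complex.real_smul, map_mul, Complex.conj_ofReal]
    push_cast; ring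
  rw [this, ← mul_assoc, ← Complex.ofReal_mul]
  congr 2
  by_cases h : ‖p.1‖ ^ 2 + ‖p.2‖ ^ 2 = 0
  · simp [h]
  · field_simp

lemma stereo_coe_div (p q : ℂ) (hq : q ≠ 0) :
    stereo ((p / q : ℂ) : OnePoint ℂ) = homogStereo (p, q) := by
  have hq' : ‖q‖ ≠ 0 := norm_ne_zero_iff.2 hq
  have hs : ‖p‖ ^ 2 + ‖q‖ ^ 2 ≠ 0 := (sq_norm_add_sq_norm_pos (p := (p, q)) (by simp [hq])).ne'
  have hs' : ‖q‖ ^ 2 + ‖p‖ ^ 2 ≠ 0 := by rwa [add_comm]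
  have hqq : conj q * q = ((‖q‖ ^ 2 : ℝ) : ℂ) := by
    rw [mul_comm, Complex.mul_conj, Complex.normSq_eq_norm_sq]
  change WithLp.toLp 2 _ = WithLp.toLp 2 _
  congr 2
  · rw [norm_div, show p * conj q = p / q * ((‖q‖ ^ 2 : ℝ) : ℂ) by
      rw [← hqq]; field_simp, mul_comm (p / q), ← mul_assoc, ← Complex.ofReal_mul]
    congr 2
    field_simp
    ring
  · simp only [norm_div]
    field_simp

lemma stereo_coe (w : ℂ) : stereo (w : OnePoint ℂ) = homogStereo (w, 1) := by
  simpa using stereo_coe_div w 1 one_ne_zero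

lemma stereo_infty (p : ℂ) (hp : p ≠ 0) : stereo OnePoint.infty = homogStereo (p, 0) := by
  have : ‖p‖ ≠ 0 := norm_ne_zero_iff.2 hp
  change WithLp.toLp 2 _ = WithLp.toLp 2 _
  simp [this]

/-- Stereographic projection from the north pole. At the north pole itself division by zero gives the
junk value `0`. -/
def stereoInv (x : WithLp 2 (ℂ × ℝ)) : ℂ := x.fst / ((1 - x.snd : ℝ) : ℂ)

lemma stereo_coe_snd_ne_one (w : ℂ) : (stereo (w : OnePoint ℂ)).snd ≠ 1 := by
  change (‖w‖ ^ 2 - 1) / (‖w‖ ^ 2 + 1) ≠ 1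
  have : 0 < ‖w‖ ^ 2 + 1 := by positivity
  rw [Ne, div_eq_one_iff_eq this.ne']
  intro h; linarith

@[simp] lemma stereo_infty_snd : (stereo OnePoint.infty).snd = 1 := rfl

@[simp] lemma stereoInv_coe (w : ℂ) : stereoInv (stereo (w : OnePoint ℂ)) = w := by
  have h : (0 : ℝ) < 1 + ‖w‖ ^ 2 := by positivity
  change ((2 / (1 + ‖w‖ ^ 2) : ℝ) : ℂ) * w / ((1 - (‖w‖ ^ 2 - 1) / (‖w‖ ^ 2 + 1) : ℝ) : ℂ) = w
  have h2 : 1 - (‖w‖ ^ 2 - 1) / (‖w‖ ^ 2 + 1) = 2 / (1 + ‖w‖ ^ 2) := by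
    rw [add_comm (‖w‖ ^ 2)]; field_simp; ring
  have h3 : ((2 / (1 + ‖w‖ ^ 2) : ℝ) : ℂ) ≠ 0 := by
    rw [Ne, Complex.ofReal_eq_zero]; positivity
  rw [h2, mul_div_cancel_left₀ _ h3]

lemma continuousAt_stereoInv {x : WithLp 2 (ℂ × ℝ)} (hx : x.snd ≠ 1) :
    ContinuousAt stereoInv x := by
  have h : ContinuousAt (fun x : WithLp 2 (ℂ × ℝ) => x.snd) x :=
    (continuous_snd.comp (WithLp.prod_continuous_ofLp 2 ℂ ℝ)).continuousAt
  have h' : ContinuousAt (fun x : WithLp 2 (ℂ × ℝ) => x.fst) x :=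
    (continuous_fst.comp (WithLp.prod_continuous_ofLp 2 ℂ ℝ)).continuousAt
  refine ContinuousAt.div h' (Complex.continuous_ofReal.continuousAt.comp
    (continuousAt_const.sub h)) ?_
  rw [Complex.ofReal_ne_zero, sub_ne_zero]
  exact hx.symm

lemma stereo_injective : Function.Injective stereo := by
  intro a b h
  induction a using OnePoint.rec with
  | infty =>
    induction b using OnePoint.rec with
    | infty => rfl
    | coe b => exact absurd (congrArg (fun x => x.snd) h).symm (stereo_coe_snd_ne_one b)
  | coe a =>
    induction b using OnePoint.rec with
    | infty => exact absurd (congrArg (fun x => x.snd) h) (stereo_coe_snd_ne_one a)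
    | coe b => simpa using congrArg stereoInv h

/-! ### Values of meromorphic functions on the sphere -/

lemma sphereValue_congr {f g : ℂ → ℂ} {z : ℂ} (h : f =ᶠ[𝓝[≠] z] g) :
    sphereValue f z = sphereValue g z := by
  unfold sphereValue limUnder
  rw [meromorphicOrderAt_congr h, map_congr h]

lemma sphereValue_of_analyticAt {f : ℂ → ℂ} {z : ℂ} (h : AnalyticAt ℂ f z) :
    sphereValue f z = f z := by
  unfold sphereValue
  rw [if_neg (not_lt.2 h.meromorphicOrderAt_nonneg),
    (h.continuousAt.tendsto.mono_left nhdsWithin_le_nhds).limUnder_eq]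

lemma sphereValue_eq_infty_iff {f : ℂ → ℂ} {z : ℂ} :
    sphereValue f z = OnePoint.infty ↔ meromorphicOrderAt f z < 0 := by
  unfold sphereValue
  split_ifs with h <;> simp [h]

lemma MeromorphicAt.eventually_sphereValue_eq {f : ℂ → ℂ} {z : ℂ} (h : MeromorphicAt f z) :
    ∀ᶠ w in 𝓝[≠] z, sphereValue f w = f w :=
  h.eventually_analyticAt.mono fun _ hw => sphereValue_of_analyticAt hw

/-- A point where `h` and `h'` do not both vanish is a regular point or a simple pole of `h' / h`,
so there the value of `h' / h` has homogeneous coordinates `[h' : h]`. -/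
lemma stereo_sphereValue_logDeriv {h : ℂ → ℂ} {z : ℂ} (hh : AnalyticAt ℂ h z)
    (h0 : (deriv h z, h z) ≠ 0) :
    stereo (sphereValue (logDeriv h) z) = homogStereo (deriv h z, h z) := by
  by_cases hz : h z = 0
  · have hd : deriv h z ≠ 0 := fun hd => h0 (by simp [hd, hz])
    have hne : meromorphicOrderAt h z ≠ 0 := by
      intro h1
      rw [← tendsto_ne_zero_iff_meromorphicOrderAt_eq_zero hh.meromorphicAt] at h1
      obtain ⟨c, hc, hl⟩ := h1
      refine hc (tendsto_nhds_unique hl ?_)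
      simpa [hz] using hh.continuousAt.tendsto.mono_left (nhdsWithin_le_nhds (s := {z}ᶜ))
    have hnt : meromorphicOrderAt h z ≠ ⊤ := by
      intro h1
      rw [meromorphicOrderAt_eq_top_iff] at h1
      have h2 : h =ᶠ[𝓝[≠] z] fun _ => 0 := h1
      have h3 := h2.nhdsNE_deriv
      have h4 : Tendsto (deriv h) (𝓝[≠] z) (𝓝 0) := by
        refine tendsto_const_nhds.congr' ?_
        filter_upwards [h3] with w hw
        simp [hw]
      exact hd (tendsto_nhds_unique
        (hh.deriv.continuousAt.tendsto.mono_left nhdsWithin_le_nhds) h4)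
    have := meromorphicOrderAt_logDeriv_eq_neg_one hh.meromorphicAt hne hnt
    rw [sphereValue_eq_infty_iff.2 (by rw [this]; decide), hz, stereo_infty _ hd]
  · rw [sphereValue_of_analyticAt (f := logDeriv h) (hh.deriv.div hh hz), logDeriv_apply,
      stereo_coe_div _ _ hz]

/-- A meromorphic function without poles on a set extends to an analytic function there. -/
lemma MeromorphicOn.exists_analyticOnNhd {f : ℂ → ℂ} {U : Set ℂ} (hf : MeromorphicOn f U)
    (h0 : ∀ z ∈ U, 0 ≤ meromorphicOrderAt f z) :
    ∃ h : ℂ → ℂ, AnalyticOnNhd ℂ h U ∧ ∀ z ∈ U, h =ᶠ[𝓝[≠] z] f := by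
  refine ⟨toMeromorphicNFOn f U, fun z hz => ?_,
    fun z hz => hf.toMeromorphicNFOn_eq_self_on_nhdsNE hz⟩
  rw [← (meromorphicNFOn_toMeromorphicNFOn f U hz).meromorphicOrderAt_nonneg_iff_analyticAt,
    meromorphicOrderAt_congr (hf.toMeromorphicNFOn_eq_self_on_nhdsNE hz)]
  exact h0 z hz

/-- If `g'' / g'` has no poles, then `g'` has neither zeros nor poles, since either would give a
pole of its logarithmic derivative; in particular `g` has no poles. -/
lemma MeromorphicOn.exists_analyticOnNhd_deriv_ne_zero {g : ℂ → ℂ} {U : Set ℂ}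
    (hg : MeromorphicOn g U) (hne : ∀ z ∈ U, meromorphicOrderAt (deriv g) z ≠ ⊤)
    (hq : ∀ z ∈ U, 0 ≤ meromorphicOrderAt (logDeriv (deriv g)) z) :
    ∃ h : ℂ → ℂ, AnalyticOnNhd ℂ h U ∧ (∀ z ∈ U, h =ᶠ[𝓝[≠] z] g) ∧ ∀ z ∈ U, deriv h z ≠ 0 := by
  have hd : ∀ z ∈ U, meromorphicOrderAt (deriv g) z = 0 := by
    intro z hz
    by_contra h
    have h1 := hq z hz
    rw [meromorphicOrderAt_logDeriv_eq_neg_one (hg.deriv z hz) h (hne z hz)] at h1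
    exact absurd h1 (by decide)
  obtain ⟨h, ha, hh⟩ := hg.exists_analyticOnNhd (fun z hz => by
    by_contra hlt
    rw [not_le] at hlt
    have hnt : meromorphicOrderAt g z ≠ ⊤ := hlt.ne_top
    lift meromorphicOrderAt g z to ℤ using hnt with n hn
    have hn0 : n < 0 := by exact_mod_cast hlt
    have h1 := meromorphicOrderAt_deriv_eq_sub_one (x := z) (f := g) (n := n)
      (by exact_mod_cast hn0.ne) hn.symm
    rw [hd z hz] at h1
    have h2 : (0 : ℤ) = n - 1 := by exact_mod_cast h1
    omega)
  refine ⟨h, ha, hh, fun z hz h0 => ?_⟩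
  have h1 := hd z hz
  rw [← meromorphicOrderAt_congr (hh z hz).nhdsNE_deriv,
    ← tendsto_ne_zero_iff_meromorphicOrderAt_eq_zero (ha z hz).deriv.meromorphicAt] at h1
  obtain ⟨c, hc, hl⟩ := h1
  refine hc (tendsto_nhds_unique hl ?_)
  simpa [h0] using (ha z hz).deriv.continuousAt.tendsto.mono_left (nhdsWithin_le_nhds (s := {z}ᶜ))

/-! ### Locally uniform convergence of sequences of functions -/

/-- For a continuous limit, locally uniform convergence on an open set is continuous convergence:
`F n w → f z` as `n → ∞` and `w → z` jointly. In this form it passes through continuous maps. -/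
lemma tendstoLocallyUniformlyOn_iff_tendsto_prod {α β : Type*} [TopologicalSpace α]
    [UniformSpace β] {F : ℕ → α → β} {f : α → β} {U : Set α} (hU : IsOpen U)
    (hf : ContinuousOn f U) :
    TendstoLocallyUniformlyOn F f atTop U ↔
      ∀ z ∈ U, Tendsto (fun y : ℕ × α => F y.1 y.2) (atTop ×ˢ 𝓝 z) (𝓝 (f z)) := by
  rw [tendstoLocallyUniformlyOn_iff_forall_tendsto]
  refine forall₂_congr fun z hz => ?_
  rw [hU.nhdsWithin_eq hz, Uniform.tendsto_nhds_right]
  have h1 : Tendsto (fun y : ℕ × α => (f z, f y.2)) (atTop ×ˢ 𝓝 z) (uniformity β) :=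
    Uniform.tendsto_nhds_right.1 ((hf.continuousAt (hU.mem_nhds hz)).tendsto.comp tendsto_snd)
  have h2 : Tendsto (fun y : ℕ × α => (f y.2, f z)) (atTop ×ˢ 𝓝 z) (uniformity β) :=
    Uniform.tendsto_nhds_left.1 ((hf.continuousAt (hU.mem_nhds hz)).tendsto.comp tendsto_snd)
  exact ⟨fun h => h1.uniformity_trans h, fun h => h2.uniformity_trans h⟩

/-- If the derivatives converge locally uniformly on a disc and the values at the centre agree,
then the functions converge locally uniformly on the disc. -/
lemma tendstoLocallyUniformlyOn_ball_of_deriv {F F' : ℕ → ℂ → ℂ} {f f' : ℂ → ℂ} {c : ℂ} {r : ℝ}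
    (hF : ∀ᶠ n in atTop, ∀ z ∈ ball c r, HasDerivAt (F n) (F' n z) z)
    (hf : ∀ z ∈ ball c r, HasDerivAt f (f' z) z)
    (h : TendstoLocallyUniformlyOn F' f' atTop (ball c r))
    (hc : ∀ᶠ n in atTop, F n c = f c) :
    TendstoLocallyUniformlyOn F f atTop (ball c r) := by
  rw [Metric.tendstoLocallyUniformlyOn_iff]
  intro ε hε x hx
  obtain ⟨ρ, hρ1, hρ2⟩ := exists_between (mem_ball.1 hx)
  have hρ0 : 0 < ρ := dist_nonneg.trans_lt hρ1
  refine ⟨ball c ρ, mem_nhdsWithin_of_mem_nhds (isOpen_ball.mem_nhds hρ1), ?_⟩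
  have hsub : closedBall c ρ ⊆ ball c r := closedBall_subset_ball hρ2
  have hK := (tendstoLocallyUniformlyOn_iff_tendstoUniformlyOn_of_compact
    (isCompact_closedBall c ρ)).1 (h.mono hsub)
  rw [Metric.tendstoUniformlyOn_iff] at hK
  filter_upwards [hF, hc, hK (ε / (2 * ρ)) (by positivity)] with n hn hcn hK z hz
  have key := (convex_closedBall c ρ).norm_image_sub_le_of_norm_hasDerivWithin_le
    (f := fun w => f w - F n w) (f' := fun w => f' w - F' n w) (C := ε / (2 * ρ))
    (x := c) (y := z)
    (fun w hw => ((hf w (hsub hw)).sub (hn w (hsub hw))).hasDerivWithinAt)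
    (fun w hw => by rw [← dist_eq_norm]; exact (hK w hw).le)
    (mem_closedBall_self hρ0.le) (ball_subset_closedBall hz)
  rw [hcn, sub_self, sub_zero, ← dist_eq_norm, ← dist_eq_norm] at key
  have hz' : dist z c ≤ ρ := (mem_ball.1 hz).le
  calc dist (f z) (F n z) ≤ ε / (2 * ρ) * dist z c := key
    _ ≤ ε / (2 * ρ) * ρ := by gcongr
    _ = ε / 2 := by field_simp
    _ < ε := by linarith

/-- If `h n'' / h n'` converges on a disc with centre `c`, then so do the solutions of
`A' = (h n'' / h n') A` with `A c = 1`, and their primitives `B` vanishing at `c`. As `h n'` is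
the multiple `h n' (c) • A`, this recovers `h n'` and `h n` from their values at `c`. -/
lemma exists_tendstoLocallyUniformlyOn_of_logDeriv_deriv {h : ℕ → ℂ → ℂ} {Q : ℕ → ℂ → ℂ}
    {q : ℂ → ℂ} {c : ℂ} {r : ℝ} (hr : 0 < r)
    (ha : ∀ᶠ n in atTop, AnalyticOnNhd ℂ (h n) (ball c r))
    (hd : ∀ᶠ n in atTop, ∀ z ∈ ball c r, deriv (h n) z ≠ 0)
    (hQ : ∀ᶠ n in atTop, ∀ z ∈ ball c r, Q n z = logDeriv (deriv (h n)) z)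
    (hq : DifferentiableOn ℂ q (ball c r))
    (hlim : TendstoLocallyUniformlyOn Q q atTop (ball c r)) :
    ∃ (A B : ℕ → ℂ → ℂ) (a b : ℂ → ℂ),
      TendstoLocallyUniformlyOn A a atTop (ball c r) ∧
      TendstoLocallyUniformlyOn B b atTop (ball c r) ∧
      (∀ z ∈ ball c r, a z ≠ 0) ∧ (∀ z ∈ ball c r, HasDerivAt b (a z) z) ∧
      ∀ᶠ n in atTop, ∀ z ∈ ball c r, deriv (h n) z = deriv (h n) c * A n z ∧
        h n z = h n c + deriv (h n) c * B n z := by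
  have hc : c ∈ ball c r := mem_ball_self hr
  obtain ⟨p, hp0, hp⟩ := hq.isExactOn_ball.with_val_at c 0
  have hexp : ∀ z ∈ ball c r, HasDerivAt (fun z => Complex.exp (p z)) (Complex.exp (p z) * q z) z :=
    fun z hz => (hp z hz).cexp
  have hexpd : DifferentiableOn ℂ (fun z => Complex.exp (p z)) (ball c r) :=
    fun z hz => (hexp z hz).differentiableAt.differentiableWithinAt
  obtain ⟨b, hb0, hb⟩ := hexpd.isExactOn_ball.with_val_at c 0
  -- Primitives of `Q n`, normalised at the centre.
  have hP : ∀ n, ∃ P : ℂ → ℂ, (AnalyticOnNhd ℂ (h n) (ball c r) →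
      (∀ z ∈ ball c r, deriv (h n) z ≠ 0) →
      (∀ z ∈ ball c r, Q n z = logDeriv (deriv (h n)) z) →
      P c = 0 ∧ ∀ z ∈ ball c r, HasDerivAt P (Q n z) z) := by
    intro n
    by_cases hn : AnalyticOnNhd ℂ (h n) (ball c r) ∧ (∀ z ∈ ball c r, deriv (h n) z ≠ 0) ∧
      (∀ z ∈ ball c r, Q n z = logDeriv (deriv (h n)) z)
    · obtain ⟨h1, h2, h3⟩ := hn
      have hQd : DifferentiableOn ℂ (Q n) (ball c r) := by
        have : DifferentiableOn ℂ (logDeriv (deriv (h n))) (ball c r) := fun z hz =>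
          (((h1 z hz).deriv.deriv).div (h1 z hz).deriv
            (h2 z hz)).differentiableAt.differentiableWithinAt
        exact this.congr h3
      obtain ⟨P, hP0, hP⟩ := hQd.isExactOn_ball.with_val_at c 0
      exact ⟨P, fun _ _ _ => ⟨hP0, hP⟩⟩
    · exact ⟨0, fun h1 h2 h3 => absurd ⟨h1, h2, h3⟩ hn⟩
  choose P hP using hP
  have hP' : ∀ᶠ n in atTop, P n c = 0 ∧ ∀ z ∈ ball c r, HasDerivAt (P n) (Q n z) z := by
    filter_upwards [ha, hd, hQ] with n h1 h2 h3 using hP n h1 h2 h3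
  have hPlim : TendstoLocallyUniformlyOn P p atTop (ball c r) :=
    tendstoLocallyUniformlyOn_ball_of_deriv (hP'.mono fun n hn => hn.2) hp hlim
      (hP'.mono fun n hn => hn.1.trans hp0.symm)
  have hpc : ContinuousOn p (ball c r) := fun z hz => (hp z hz).continuousAt.continuousWithinAt
  -- `h n'` satisfies the same linear equation as `exp (P n)`.
  have hderiv : ∀ᶠ n in atTop, ∀ z ∈ ball c r,
      deriv (h n) z = deriv (h n) c * Complex.exp (P n z) := by
    filter_upwards [ha, hd, hQ, hP'] with n h1 h2 h3 h4 z hz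
    have hder : ∀ w ∈ ball c r,
        HasDerivAt (fun w => deriv (h n) w * Complex.exp (-P n w)) 0 w := by
      intro w hw
      have e1 := (h1 w hw).deriv.differentiableAt.hasDerivAt
      have e2 := (h4.2 w hw).neg.cexp
      refine (e1.mul e2).congr_deriv ?_
      rw [h3 w hw, logDeriv_apply]
      have := h2 w hw
      field_simp
      simp
    have hconst := (convex_ball c r).is_const_of_fderivWithin_eq_zero (𝕜 := ℂ)
      (fun w hw => (hder w hw).differentiableAt.differentiableWithinAt)
      (fun w hw => by
        rw [fderivWithin_of_isOpen isOpen_ball hw]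
        ext
        simp [(hder w hw).deriv]) hz hc
    rw [h4.1, neg_zero, Complex.exp_zero, mul_one] at hconst
    rw [← hconst, mul_assoc, ← Complex.exp_add, neg_add_cancel, Complex.exp_zero, mul_one]
  refine ⟨fun n z => Complex.exp (P n z), fun n z => (h n z - h n c) / deriv (h n) c,
    fun z => Complex.exp (p z), b, ?_, ?_, fun z _ => Complex.exp_ne_zero _, hb, ?_⟩
  · rw [tendstoLocallyUniformlyOn_iff_tendsto_prod isOpen_ball hexpd.continuousOn]
    rw [tendstoLocallyUniformlyOn_iff_tendsto_prod isOpen_ball hpc] at hPlim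
    exact fun z hz => (Complex.continuous_exp.tendsto _).comp (hPlim z hz)
  · refine tendstoLocallyUniformlyOn_ball_of_deriv (F' := fun n z => Complex.exp (P n z))
      ?_ hb ?_ ?_
    · filter_upwards [ha, hd, hderiv] with n h1 h2 h3 z hz
      have e := (((h1 z hz).differentiableAt.hasDerivAt).sub_const (h n c)).div_const
        (deriv (h n) c)
      rwa [h3 z hz, mul_div_cancel_left₀ _ (h2 c hc)] at e
    · rw [tendstoLocallyUniformlyOn_iff_tendsto_prod isOpen_ball hexpd.continuousOn]
      rw [tendstoLocallyUniformlyOn_iff_tendsto_prod isOpen_ball hpc] at hPlim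
      exact fun z hz => (Complex.continuous_exp.tendsto _).comp (hPlim z hz)
    · exact Eventually.of_forall fun n => by simp [hb0]
  · filter_upwards [hd, hderiv] with n h2 h3 z hz
    refine ⟨h3 z hz, ?_⟩
    have := h2 c hc
    field_simp
    ring

/-! ### Local subsequential convergence -/

/-- Near every point, the logarithmic derivatives of `g n` are governed by a bounded sequence of
parameters `v n ∈ ℂ²`, the normalised values `(g n, (g n)')` at that point: along any subsequence
along which the parameters converge, so do the logarithmic derivatives. -/
theorem exists_nhds_forall_sphericallyTendsto_logDeriv {U : Set ℂ} (hU : IsOpen U)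
    {g : ℕ → ℂ → ℂ} (hg : ∀ n, MeromorphicOn (g n) U)
    (hne : ∀ n, ∀ z ∈ U, meromorphicOrderAt (deriv (g n)) z ≠ ⊤)
    {F : ℂ → ℂ} (hF : MeromorphicOn F U) (hF0 : ∀ z ∈ U, 0 ≤ meromorphicOrderAt F z)
    (hlim : SphericallyTendsto (fun n => sphereValue (logDeriv (deriv (g n)))) (sphereValue F) U)
    {c : ℂ} (hcU : c ∈ U) :
    ∃ V, IsOpen V ∧ c ∈ V ∧ V ⊆ U ∧ ∃ v : ℕ → ℂ × ℂ, (∀ n, v n ∈ closedBall 0 1) ∧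
      ∀ φ : ℕ → ℕ, StrictMono φ → ∀ w, Tendsto (v ∘ φ) atTop (𝓝 w) →
        ∃ G : ℂ → ℂ, MeromorphicOn G V ∧
          SphericallyTendsto (fun k => sphereValue (logDeriv (g (φ k)))) (sphereValue G) V := by
  obtain ⟨f, hfa, hfF⟩ := hF.exists_analyticOnNhd hF0
  have hFf : ∀ z ∈ U, sphereValue F z = f z := fun z hz => by
    rw [← sphereValue_congr (hfF z hz), sphereValue_of_analyticAt (hfa z hz)]
  have hfc : ContinuousOn f U := hfa.continuousOn
  have hcoe : Continuous fun w : ℂ => stereo (w : OnePoint ℂ) := by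
    simp_rw [stereo_coe]
    exact continuous_iff_continuousAt.2 fun w =>
      (continuousAt_homogStereo (p := (w, 1)) (by simp)).comp
        (f := fun w : ℂ => (w, (1 : ℂ))) (by fun_prop)
  have hsc : ContinuousOn (fun z => stereo (sphereValue F z)) U :=
    (hcoe.comp_continuousOn hfc).congr fun z hz => by simp [hFf z hz]
  have hlim' := (tendstoLocallyUniformlyOn_iff_tendsto_prod hU hsc).1 hlim
  -- The finite values of the `(g n)'' / (g n)'`.
  set Q : ℕ → ℂ → ℂ := fun n z => stereoInv (stereo (sphereValue (logDeriv (deriv (g n))) z))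
    with hQdef
  have hQlim : TendstoLocallyUniformlyOn Q f atTop U := by
    rw [tendstoLocallyUniformlyOn_iff_tendsto_prod hU hfc]
    intro z hz
    have h1 := hlim' z hz
    simp only [hFf z hz] at h1
    have h2 := (continuousAt_stereoInv (stereo_coe_snd_ne_one (f z))).tendsto.comp h1
    rwa [stereoInv_coe] at h2
  have hfin : ∀ᶠ y : ℕ × ℂ in atTop ×ˢ 𝓝 c,
      0 ≤ meromorphicOrderAt (logDeriv (deriv (g y.1))) y.2 := by
    have h1 := hlim' c hcU
    simp only [hFf c hcU] at h1
    have h2 : Continuous fun x : WithLp 2 (ℂ × ℝ) => x.snd :=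
      continuous_snd.comp (WithLp.prod_continuous_ofLp 2 ℂ ℝ)
    have h3 := ((h2.tendsto _).comp h1).eventually_ne (stereo_coe_snd_ne_one (f c))
    filter_upwards [h3] with y hy
    by_contra hlt
    rw [not_le, ← sphereValue_eq_infty_iff] at hlt
    exact hy (by simp [hlt])
  rw [eventually_prod_iff] at hfin
  obtain ⟨pN, hpN, pV, hpV, hfin⟩ := hfin
  obtain ⟨r, hr, hrU⟩ := Metric.mem_nhds_iff.1 (inter_mem (hU.mem_nhds hcU) hpV)
  have hVU : ball c r ⊆ U := fun z hz => (hrU hz).1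
  have hc : c ∈ ball c r := mem_ball_self hr
  -- Analytic versions of the `g n`, for large `n`.
  have hext : ∀ n, ∃ h : ℂ → ℂ, pN n → AnalyticOnNhd ℂ h (ball c r) ∧
      (∀ z ∈ ball c r, h =ᶠ[𝓝[≠] z] g n) ∧ ∀ z ∈ ball c r, deriv h z ≠ 0 := by
    intro n
    by_cases hn : pN n
    · obtain ⟨h, hh⟩ := ((hg n).mono_set hVU).exists_analyticOnNhd_deriv_ne_zero
        (fun z hz => hne n z (hVU hz)) (fun z hz => hfin hn (hrU hz).2)
      exact ⟨h, fun _ => hh⟩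
    · exact ⟨0, fun h => absurd h hn⟩
  choose h hh using hext
  obtain ⟨A, B, a, b, hA, hB, ha0, hb, hrep⟩ :=
    exists_tendstoLocallyUniformlyOn_of_logDeriv_deriv (h := h) (Q := Q) hr
      (hpN.mono fun n hn => (hh n hn).1) (hpN.mono fun n hn => (hh n hn).2.2)
      (hpN.mono fun n hn z hz => by
        obtain ⟨h1, h2, h3⟩ := hh n hn
        have e1 : logDeriv (deriv (h n)) =ᶠ[𝓝[≠] z] logDeriv (deriv (g n)) :=
          logDeriv_congr_nhdsNE (h2 z hz).nhdsNE_deriv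
        rw [hQdef]
        simp only
        rw [← sphereValue_congr e1, sphereValue_of_analyticAt (f := logDeriv (deriv (h n)))
          ((h1 z hz).deriv.deriv.div (h1 z hz).deriv (h3 z hz)), stereoInv_coe])
      (fun z hz => (hfa z (hVU hz)).differentiableAt.differentiableWithinAt)
      (hQlim.mono hVU)
  have hbd : DifferentiableOn ℂ b (ball c r) :=
    fun z hz => (hb z hz).differentiableAt.differentiableWithinAt
  have hac : ContinuousOn a (ball c r) := by
    have e : AnalyticOnNhd ℂ (deriv b) (ball c r) := (hbd.analyticOnNhd isOpen_ball).deriv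
    exact e.continuousOn.congr fun z hz => (hb z hz).deriv.symm
  rw [tendstoLocallyUniformlyOn_iff_tendsto_prod isOpen_ball hac] at hA
  rw [tendstoLocallyUniformlyOn_iff_tendsto_prod isOpen_ball hbd.continuousOn] at hB
  set x : ℕ → ℂ × ℂ := fun n => (h n c, deriv (h n) c) with hx
  have hx0 : ∀ n, pN n → x n ≠ 0 := fun n hn h0 =>
    (hh n hn).2.2 c hc (congrArg Prod.snd h0)
  refine ⟨ball c r, isOpen_ball, hc, hVU, fun n => ‖x n‖⁻¹ • x n, fun n => ?_,
    fun φ hφ w hw => ?_⟩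
  · rw [mem_closedBall_zero_iff, norm_smul, norm_inv, norm_norm]
    exact inv_mul_le_one
  have hw0 : w ≠ 0 := by
    have h1 : Tendsto (fun k => ‖‖x (φ k)‖⁻¹ • x (φ k)‖) atTop (𝓝 ‖w‖) := hw.norm
    have h2 : Tendsto (fun k => ‖‖x (φ k)‖⁻¹ • x (φ k)‖) atTop (𝓝 1) := by
      refine tendsto_const_nhds.congr' ?_
      filter_upwards [hφ.tendsto_atTop.eventually hpN] with k hk
      rw [norm_smul, norm_inv, norm_norm, inv_mul_cancel₀ (norm_ne_zero_iff.2 (hx0 _ hk))]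
    intro h0
    rw [h0, norm_zero] at h1
    exact zero_ne_one (tendsto_nhds_unique h1 h2)
  -- The limit is the logarithmic derivative of `w.1 + w.2 * b`.
  have hql : ∀ z ∈ ball c r, HasDerivAt (fun z => w.1 + w.2 * b z) (w.2 * a z) z :=
    fun z hz => ((hb z hz).const_mul w.2).const_add w.1
  have hqa : AnalyticOnNhd ℂ (fun z => w.1 + w.2 * b z) (ball c r) := fun z hz =>
    analyticAt_const.add (analyticAt_const.mul (hbd.analyticOnNhd isOpen_ball z hz))
  have hnz : ∀ z ∈ ball c r, (w.2 * a z, w.1 + w.2 * b z) ≠ 0 := by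
    intro z hz h0
    have h1 : w.2 = 0 := by simpa [ha0 z hz] using congrArg Prod.fst h0
    have h2 : w.1 = 0 := by simpa [h1] using congrArg Prod.snd h0
    exact hw0 (Prod.ext h2 h1)
  have hlimval : ∀ z ∈ ball c r, stereo (sphereValue (logDeriv fun z => w.1 + w.2 * b z) z) =
      homogStereo (w.2 * a z, w.1 + w.2 * b z) := by
    intro z hz
    have e := stereo_sphereValue_logDeriv (hqa z hz) (by rw [(hql z hz).deriv]; exact hnz z hz)
    rwa [(hql z hz).deriv] at e
  refine ⟨logDeriv fun z => w.1 + w.2 * b z, fun z hz =>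
    (hqa z hz).meromorphicAt.deriv.div (hqa z hz).meromorphicAt, ?_⟩
  have hcont : ContinuousOn
      (fun z => stereo (sphereValue (logDeriv fun z => w.1 + w.2 * b z) z)) (ball c r) := by
    refine ContinuousOn.congr (f := fun z => homogStereo (w.2 * a z, w.1 + w.2 * b z)) ?_ hlimval
    intro z hz
    have h1 : ContinuousWithinAt (fun z => (w.2 * a z, w.1 + w.2 * b z)) (ball c r) z :=
      (continuousWithinAt_const.mul (hac z hz)).prodMk
        (continuousWithinAt_const.add (continuousWithinAt_const.mul (hbd.continuousOn z hz)))
    exact ContinuousAt.comp_continuousWithinAt (f := fun z => (w.2 * a z, w.1 + w.2 * b z))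
      (continuousAt_homogStereo (hnz z hz)) h1
  rw [SphericallyTendsto, tendstoLocallyUniformlyOn_iff_tendsto_prod isOpen_ball hcont]
  intro z hz
  rw [hlimval z hz]
  have hφ' : Tendsto (fun y : ℕ × ℂ => (φ y.1, y.2)) (atTop ×ˢ 𝓝 z) (atTop ×ˢ 𝓝 z) :=
    (hφ.tendsto_atTop.comp tendsto_fst).prodMk tendsto_snd
  have hv : Tendsto (fun y : ℕ × ℂ => ‖x (φ y.1)‖⁻¹ • x (φ y.1)) (atTop ×ˢ 𝓝 z) (𝓝 w) :=
    hw.comp tendsto_fst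
  have hA' := (hA z hz).comp hφ'
  have hB' := (hB z hz).comp hφ'
  have key : Tendsto (fun y : ℕ × ℂ =>
      ((‖x (φ y.1)‖⁻¹ • x (φ y.1)).2 * A (φ y.1) y.2,
        (‖x (φ y.1)‖⁻¹ • x (φ y.1)).1 + (‖x (φ y.1)‖⁻¹ • x (φ y.1)).2 * B (φ y.1) y.2))
      (atTop ×ˢ 𝓝 z) (𝓝 (w.2 * a z, w.1 + w.2 * b z)) :=
    (hv.snd_nhds.mul hA').prodMk_nhds (hv.fst_nhds.add (hv.snd_nhds.mul hB'))
  refine ((continuousAt_homogStereo (hnz z hz)).tendsto.comp key).congr' ?_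
  have hev := (hφ.tendsto_atTop.eventually (hpN.and hrep)).prod_mk (isOpen_ball.mem_nhds hz)
  filter_upwards [hev] with y hy
  obtain ⟨⟨hn, hrn⟩, hyV⟩ := hy
  obtain ⟨h1, h2, h3⟩ := hh _ hn
  rw [← sphereValue_congr (logDeriv_congr_nhdsNE (h2 _ hyV)),
    stereo_sphereValue_logDeriv (h1 _ hyV) (fun h0 => h3 _ hyV (congrArg Prod.fst h0)),
    (hrn _ hyV).1, (hrn _ hyV).2,
    ← homogStereo_smul (inv_ne_zero (norm_ne_zero_iff.2 (hx0 _ hn)))]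
  simp only [Function.comp, hx, Prod.smul_mk, Complex.real_smul]
  congr 2 <;> ring

/-! ### Gluing -/

/-- Limits on the members of an open cover glue to a limit on the union: they agree on overlaps,
so `G` can be read off from the pointwise limit on the sphere. -/
lemma exists_sphericallyTendsto_of_cover {ι : Type*} {U : Set ℂ} {V : ι → Set ℂ}
    (hV : ∀ i, IsOpen (V i)) (hUV : U = ⋃ i, V i) {s : ℕ → ℂ → OnePoint ℂ} {G : ι → ℂ → ℂ}
    (hG : ∀ i, MeromorphicOn (G i) (V i))
    (hlim : ∀ i, SphericallyTendsto s (sphereValue (G i)) (V i)) :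
    ∃ G : ℂ → ℂ, MeromorphicOn G U ∧ SphericallyTendsto s (sphereValue G) U := by
  set L : ℂ → WithLp 2 (ℂ × ℝ) := fun z => limUnder atTop fun n => stereo (s n z)
  have hL : ∀ i, ∀ z ∈ V i, L z = stereo (sphereValue (G i) z) := fun i z hz =>
    ((hlim i).tendsto_at hz).limUnder_eq
  have heq : ∀ i, ∀ z ∈ V i, G i =ᶠ[𝓝[≠] z] fun w => stereoInv (L w) := by
    intro i z hz
    filter_upwards [(hG i z hz).eventually_sphereValue_eq,
      mem_nhdsWithin_of_mem_nhds ((hV i).mem_nhds hz)] with w h1 h2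
    rw [hL i w h2, h1, stereoInv_coe]
  refine ⟨fun w => stereoInv (L w), fun z hz => ?_, ?_⟩
  · rw [hUV] at hz
    obtain ⟨i, hi⟩ := mem_iUnion.1 hz
    exact (hG i z hi).congr (heq i z hi)
  · rw [hUV]
    refine tendstoLocallyUniformlyOn_iUnion hV fun i => ?_
    refine (hlim i).congr_right fun z hz => ?_
    simp only
    rw [sphereValue_congr (heq i z hz)]

/-- Along some subsequence, the logarithmic derivatives of `g n` converge locally uniformly to a
meromorphic function wherever the limit of `(g n)'' / (g n)'` is finite. -/
theorem exists_subseq_sphericallyTendsto_logDeriv {U : Set ℂ} (hU : IsOpen U)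
    {g : ℕ → ℂ → ℂ} (hg : ∀ n, MeromorphicOn (g n) U)
    (hne : ∀ n, ∀ z ∈ U, meromorphicOrderAt (deriv (g n)) z ≠ ⊤)
    {F : ℂ → ℂ} (hF : MeromorphicOn F U) (hF0 : ∀ z ∈ U, 0 ≤ meromorphicOrderAt F z)
    (hlim : SphericallyTendsto (fun n => sphereValue (logDeriv (deriv (g n))))
      (sphereValue F) U) :
    ∃ φ : ℕ → ℕ, StrictMono φ ∧ ∃ G : ℂ → ℂ, MeromorphicOn G U ∧
      SphericallyTendsto (fun k => sphereValue (logDeriv (g (φ k)))) (sphereValue G) U := by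
  choose! V hVo hcV hVU v hv hloc using fun (c : ℂ) (hc : c ∈ U) =>
    exists_nhds_forall_sphericallyTendsto_logDeriv hU hg hne hF hF0 hlim hc
  obtain ⟨t, htU, htc, ht⟩ := TopologicalSpace.countable_cover_nhdsWithin (f := V) (s := U)
    fun c hc => mem_nhdsWithin_of_mem_nhds ((hVo c hc).mem_nhds (hcV c hc))
  have : Countable t := htc.to_subtype
  -- The diagonal argument: a countable product of compact metrisable spaces is sequentially compact.
  have hcomp : IsCompact (pi univ fun _ : t => closedBall (0 : ℂ × ℂ) 1) :=
    isCompact_univ_pi fun _ => isCompact_closedBall _ _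
  obtain ⟨w, -, φ, hφ, hw⟩ := hcomp.tendsto_subseq (x := fun n (c : t) => v c n)
    fun n c _ => hv c (htU c.2) n
  rw [tendsto_pi_nhds] at hw
  choose G hG hGlim using fun c : t => hloc c (htU c.2) φ hφ (w c) (hw c)
  refine ⟨φ, hφ, exists_sphericallyTendsto_of_cover (V := fun c : t => V c)
    (fun c => hVo c (htU c.2)) (Subset.antisymm ?_ ?_) hG hGlim⟩
  · rwa [← biUnion_eq_iUnion t fun c _ => V c]
  · exact iUnion_subset fun c => hVU c (htU c.2)

/-! ### The exceptional set -/

lemma MeromorphicAt.eventually_meromorphicOrderAt_nonneg {f : ℂ → ℂ} {z : ℂ}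
    (h : MeromorphicAt f z) : ∀ᶠ w in 𝓝[≠] z, 0 ≤ meromorphicOrderAt f w :=
  h.eventually_analyticAt.mono fun _ hw => hw.meromorphicOrderAt_nonneg

lemma isOpen_diff_polesOn {F : ℂ → ℂ} {D : Set ℂ} (hD : IsOpen D) (hF : MeromorphicOn F D) :
    IsOpen (D \ polesOn F D) := by
  rw [isOpen_iff_mem_nhds]
  rintro z ⟨hz, hzp⟩
  have h0 : 0 ≤ meromorphicOrderAt F z := by
    by_contra h
    exact hzp ⟨hz, not_le.1 h⟩
  have h1 : ∀ᶠ w in 𝓝 z, 0 ≤ meromorphicOrderAt F w := by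
    filter_upwards [eventually_nhdsWithin_iff.1 (hF z hz).eventually_meromorphicOrderAt_nonneg]
      with w hw
    by_cases hwz : w = z
    · rwa [hwz]
    · exact hw hwz
  filter_upwards [h1, hD.mem_nhds hz] with w h2 h3 using ⟨h3, fun h4 => not_lt.2 h2 h4.2⟩

lemma nonempty_diff_polesOn {F : ℂ → ℂ} {D : Set ℂ} (hD : IsOpen D) (hDne : D.Nonempty)
    (hF : MeromorphicOn F D) : (D \ polesOn F D).Nonempty := by
  obtain ⟨z, hz⟩ := hDne
  obtain ⟨w, h1, h2⟩ := ((hF z hz).eventually_meromorphicOrderAt_nonneg.and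
    (mem_nhdsWithin_of_mem_nhds (hD.mem_nhds hz))).exists
  exact ⟨w, h2, fun h3 => not_lt.2 h1 h3.2⟩

end

/-! ### Logarithmic derivatives of iterated derivatives -/

theorem lemma2 (D : Set ℂ) (hDopen : IsOpen D) (hDconn : IsConnected D)
    (m : ℕ) (hm : 1 ≤ m) (f : ℕ → ℂ → ℂ) (hf : ∀ n, MeromorphicOn (f n) D)
    (hne : ∀ n, ∃ z ∈ D, meromorphicOrderAt (iteratedDeriv m (f n)) z ≠ ⊤)
    (F : ℂ → ℂ) (hF : MeromorphicOn F D)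
    (hlim : SphericallyTendsto
      (fun n => sphereValue (fun z => iteratedDeriv (m + 1) (f n) z / iteratedDeriv m (f n) z))
      (sphereValue F) D) :
    (∃ φ : ℕ → ℕ, StrictMono φ ∧ ∃ G : ℂ → ℂ, MeromorphicOn G (D \ polesOn F D) ∧
      SphericallyTendsto
        (fun k => sphereValue
          (fun z => iteratedDeriv m (f (φ k)) z / iteratedDeriv (m - 1) (f (φ k)) z))
        (sphereValue G) (D \ polesOn F D)) ∧
    (∀ φ : ℕ → ℕ, StrictMono φ → ¬ SphericallyTendsto
        (fun k => sphereValue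
          (fun z => iteratedDeriv m (f (φ k)) z / iteratedDeriv (m - 1) (f (φ k)) z))
        (fun _ => OnePoint.infty) (D \ polesOn F D)) := by
  obtain ⟨m, rfl⟩ : ∃ k, m = k + 1 := ⟨m - 1, by omega⟩
  simp only [Nat.add_sub_cancel]
  set g : ℕ → ℂ → ℂ := fun n => iteratedDeriv m (f n) with hgdef
  have hg : ∀ n, MeromorphicOn (g n) D := fun n => by
    simp only [hgdef, iteratedDeriv_eq_iterate]
    exact (hf n).iterated_deriv
  have hg1 : ∀ n, iteratedDeriv (m + 1) (f n) = deriv (g n) := fun n => iteratedDeriv_succ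
  have hg2 : ∀ n, iteratedDeriv (m + 1 + 1) (f n) = deriv (deriv (g n)) := fun n => by
    rw [iteratedDeriv_succ, hg1]
  simp only [hg1, hg2] at hlim hne ⊢
  change SphericallyTendsto (fun n => sphereValue (logDeriv (deriv (g n)))) (sphereValue F) D
    at hlim
  have hne' : ∀ n, ∀ z ∈ D, meromorphicOrderAt (deriv (g n)) z ≠ ⊤ := fun n =>
    ((hg n).deriv.exists_meromorphicOrderAt_ne_top_iff_forall_mem hDconn).1 (hne n)
  set U := D \ polesOn F D with hUdef
  have hUD : U ⊆ D := Set.sdiff_subset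
  have hU : IsOpen U := isOpen_diff_polesOn hDopen hF
  have hF0 : ∀ z ∈ U, 0 ≤ meromorphicOrderAt F z := fun z hz => by
    by_contra h
    exact hz.2 ⟨hz.1, not_le.1 h⟩
  have hlimU : SphericallyTendsto (fun n => sphereValue (logDeriv (deriv (g n))))
      (sphereValue F) U := hlim.mono hUD
  have main : ∀ φ : ℕ → ℕ, StrictMono φ → ∃ ψ : ℕ → ℕ, StrictMono ψ ∧ ∃ G : ℂ → ℂ,
      MeromorphicOn G U ∧ SphericallyTendsto
        (fun k => sphereValue (logDeriv (g (φ (ψ k))))) (sphereValue G) U := fun φ hφ =>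
    exists_subseq_sphericallyTendsto_logDeriv hU (g := fun n => g (φ n))
      (fun n => (hg (φ n)).mono_set hUD) (fun n z hz => hne' (φ n) z (hUD hz))
      (hF.mono_set hUD) hF0 (fun u hu z hz => by
        obtain ⟨t, ht, h⟩ := hlimU u hu z hz
        exact ⟨t, ht, hφ.tendsto_atTop.eventually h⟩)
  refine ⟨main id strictMono_id, fun φ hφ hinf => ?_⟩
  obtain ⟨ψ, hψ, G, hG, hGlim⟩ := main φ hφ
  have hGinf : ∀ z ∈ U, sphereValue G z = OnePoint.infty := fun z hz =>
    stereo_injective (tendsto_nhds_unique (hGlim.tendsto_at hz)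
      ((hinf.tendsto_at hz).comp hψ.tendsto_atTop))
  -- A meromorphic function does not have poles throughout a non-empty open set.
  obtain ⟨z, hz⟩ := nonempty_diff_polesOn hDopen hDconn.nonempty hF
  obtain ⟨w, h1, h2⟩ := ((hG z hz).eventually_meromorphicOrderAt_nonneg.and
    (mem_nhdsWithin_of_mem_nhds (hU.mem_nhds hz))).exists
  exact not_lt.2 h1 (sphereValue_eq_infty_iff.1 (hGinf w h2))
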